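/- All topological spaces $X$, $Y$ below are Tychonoff (completely regular and Hausdorff). For such a space $Y$ let $C(Y)$ be the vector space of all continuous real-valued functions on $Y$. Write $C_p(Y)$ and $C_k(Y)$ for $C(Y)$ endowed with the topology of pointwise convergence and with the compact-open topology, respectively, and $C_k(Y)_w$ for $C(Y)$ endowed with the weak topology of the locally convex space $C_k(Y)$, i.e. the coarsest topology making every continuous linear functional on $C_k(Y)$ continuous. A space $X$ is called a $\Delta$-space if for every decreasing sequence $(D_n)_{n\in\omega}$ of subsets of $X$ with empty intersection there is a decreasing sequence $(V_n)_{n\in\omega}$ of open subsets of $X$ with empty intersection such that $D_n\subseteq V_n$ for every $n$. **Theorem.** Let $X$ be a Tychonoff $\Delta$-space and let $Y$ be a Tychonoff space. If there is a continuous linear surjection $T\colon C_p(X)\to C_k(Y)_w$, then $C_k(Y)_w=C_p(Y)=C_k(Y)$, that is, the weak topology, the topology of pointwise convergence and the compact-open topology coincide on $C(Y)$. Consequently, if $Y$ is an infinite compact space, then there is no continuous linear surjection $T\colon C_p(X)\to C_k(Y)_w$. -/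

import Mathlib

open Topology

/-- A `Δ`-space: every decreasing sequence of arbitrary subsets with empty intersection is
dominated termwise by a decreasing sequence of open subsets with empty intersection. -/
def IsDeltaSpace (X : Type*) [TopologicalSpace X] : Prop :=
  ∀ D : ℕ → Set X, Antitone D → (⋂ n, D n) = ∅ →
    ∃ V : ℕ → Set X, Antitone V ∧ (∀ n, IsOpen (V n)) ∧ (⋂ n, V n) = ∅ ∧ ∀ n, D n ⊆ V n

/-- The topology `τ_p` of pointwise convergence on `C(X, ℝ)`, that is, the topology of `C_p(X)`:
the subspace topology inherited from the product `ℝ^X`. -/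
abbrev pointwiseTopology (X : Type*) [TopologicalSpace X] : TopologicalSpace C(X, ℝ) :=
  TopologicalSpace.induced (fun (f : C(X, ℝ)) (x : X) => f x) Pi.topologicalSpace

/-- The compact-open topology `τ_k` on `C(X, ℝ)`, that is, the topology of `C_k(X)`. -/
abbrev compactOpenTopology (X : Type*) [TopologicalSpace X] : TopologicalSpace C(X, ℝ) :=
  ContinuousMap.compactOpen

/-- The weak topology `w` of the locally convex space `C_k(X)`, that is, the topology of
`C_k(X)_w`, as a topology on `C(X, ℝ)`. Here `C(X, ℝ)` carries the compact-open topology, so this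
is the coarsest topology for which all `τ_k`-continuous linear functionals are continuous. -/
noncomputable abbrev weakTopology (X : Type*) [TopologicalSpace X] : TopologicalSpace C(X, ℝ) :=
  TopologicalSpace.induced (toWeakSpace ℝ C(X, ℝ)) inferInstance

/-!
The mechanism is that a weak*-continuous linear map from a Banach space `E` into the dual of
`C_p(X)` has finite rank. That dual consists of the finitely supported real functions on `X`,
acting by `f ↦ ∑ x, l x * f x`. Since `X` is Tychonoff, the elements with at most `n` support points
form a weak*-closed set, so `E` is a countable union of closed sets `A n` of vectors whose image has
at most `n` support points. By the Baire category theorem some `A n` contains a ball; taking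
differences and rescaling, all images have at most `2 * n` support points
(`exists_card_support_le`). A linear space of finitely supported functions whose supports have
bounded size lives on one finite set (`exists_supported_of_card_support_le`), hence is
finite-dimensional.

Let now `T` be a continuous linear surjection from `C_p(X)` onto `C_k(Y)_w` and let `K ⊆ Y` be
compact. Composing a functional `e` on the Banach space `C(K)` with restriction to `K` and with `T`
yields a continuous functional on `C_p(X)`, which gives a linear map from the dual of `C(K)` to the
dual of `C_p(X)`. It has finite rank, but it is injective on combinations of evaluations at points
of `K`, because `T` is onto and `Y` is Tychonoff. So `K` is finite (`finite_of_isCompact`). Once all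
compact subsets of `Y` are finite, the compact-open topology is the pointwise one, and the weak
topology lies between the two.
-/

open Set

/-! ### Tychonoff spaces and evaluation functionals -/

lemma exists_continuousMap_eq_one_eqOn_zero {X : Type*} [TopologicalSpace X]
    [CompletelyRegularSpace X] {x : X} {U : Set X} (hU : IsOpen U) (hx : x ∈ U) :
    ∃ f : C(X, ℝ), f x = 1 ∧ ∀ y ∉ U, f y = 0 := by
  obtain ⟨f, hf, hfx, hfU⟩ := CompletelyRegularSpace.completely_regular x Uᶜ hU.isClosed_compl
    (by simpa using hx)
  refine ⟨⟨fun y => 1 - (f y : ℝ), by fun_prop⟩, by simp [hfx], fun y hy => ?_⟩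
  have := hfU hy
  simp [this]

/-- Evaluation at a point, as a linear functional on `C(X, ℝ)`. -/
def evalFunctional {X : Type*} [TopologicalSpace X] (x : X) : C(X, ℝ) →ₗ[ℝ] ℝ where
  toFun f := f x
  map_add' _ _ := rfl
  map_smul' _ _ := rfl

lemma linearCombination_evalFunctional {X : Type*} [TopologicalSpace X] (l : X →₀ ℝ)
    (f : C(X, ℝ)) :
    Finsupp.linearCombination ℝ evalFunctional l f = ∑ x ∈ l.support, l x * f x := by
  simp [Finsupp.linearCombination_apply, Finsupp.sum, evalFunctional]

lemma linearIndependent_evalFunctional (X : Type*) [TopologicalSpace X] [T35Space X] :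
    LinearIndependent ℝ (evalFunctional : X → C(X, ℝ) →ₗ[ℝ] ℝ) := by
  classical
  rw [linearIndependent_iff]
  intro l hl
  by_contra hne
  obtain ⟨x, hx⟩ := Finsupp.support_nonempty_iff.mpr hne
  obtain ⟨f, hfx, hf⟩ := exists_continuousMap_eq_one_eqOn_zero
    (U := (↑(l.support.erase x) : Set X)ᶜ) (Finset.finite_toSet _).isClosed.isOpen_compl
    (x := x) (by simp)
  have h := linearCombination_evalFunctional l f
  rw [hl, Finset.sum_eq_single_of_mem x hx] at h
  · simp only [LinearMap.zero_apply, hfx, mul_one] at h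
    exact Finsupp.mem_support_iff.mp hx h.symm
  · intro y hy hyx
    rw [hf y (by simp [hyx, Finsupp.mem_support_iff.mp hy]), mul_zero]

lemma mem_span_evalFunctional {X : Type*} [TopologicalSpace X] (φ : C(X, ℝ) →ₗ[ℝ] ℝ)
    (hφ : Continuous[pointwiseTopology X, inferInstance] φ) :
    φ ∈ Submodule.span ℝ (range (evalFunctional : X → C(X, ℝ) →ₗ[ℝ] ℝ)) := by
  rw [LinearMap.mem_span_iff_continuous]
  have : pointwiseTopology X = ⨅ x : X, TopologicalSpace.induced (evalFunctional x)
      (inferInstance : TopologicalSpace ℝ) := by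
    simp only [pointwiseTopology, Pi.topologicalSpace, induced_iInf, induced_compose]
    rfl
  rwa [this] at hφ

/-! ### Linear spaces of finitely supported functions -/

/-- An element of maximal support size has a support that contains all the others: otherwise a
generic combination would have a larger support. -/
lemma exists_supported_of_card_support_le {ι 𝕜 : Type*} [Field 𝕜] [Infinite 𝕜]
    (W : Submodule 𝕜 (ι →₀ 𝕜)) {n : ℕ} (hW : ∀ w ∈ W, w.support.card ≤ n) :
    ∃ s : Finset ι, W ≤ Finsupp.supported 𝕜 𝕜 (s : Set ι) := by
  classical
  have hfin : ((fun w : ι →₀ 𝕜 => w.support.card) '' (W : Set (ι →₀ 𝕜))).Finite :=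
    (finite_Iic n).subset (by rintro _ ⟨w, hw, rfl⟩; exact hW w hw)
  obtain ⟨_, ⟨w, hw, rfl⟩, hmax⟩ := hfin.exists_maximal ⟨_, mem_image_of_mem _ W.zero_mem⟩
  refine ⟨w.support, fun v hv => ?_⟩
  rw [Finsupp.mem_supported]
  intro y hy
  by_contra hyw
  -- the scalars `t` for which some coordinate in `supp w ∪ {y}` vanishes in `w + t • v`
  obtain ⟨t, ht⟩ :=
    Infinite.exists_notMem_finset (insert 0 (w.support.image fun x => -w x / v x))
  have hy0 : v y ≠ 0 := by simpa using hy
  have hwy : w y = 0 := by simpa using hyw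
  simp only [Finset.mem_insert, Finset.mem_image, not_or, not_exists, not_and] at ht
  have hsub : insert y w.support ⊆ (w + t • v).support := by
    intro x hx
    rw [Finsupp.mem_support_iff, Finsupp.add_apply, Finsupp.smul_apply, smul_eq_mul]
    rcases Finset.mem_insert.mp hx with rfl | hx
    · rw [hwy, zero_add]
      exact mul_ne_zero ht.1 hy0
    · intro h
      have hwx := Finsupp.mem_support_iff.mp hx
      have hvx : v x ≠ 0 := fun h0 => hwx (by simpa [h0] using h)
      exact ht.2 x hx (by rw [div_eq_iff hvx]; linear_combination -h)
  have hcard := Finset.card_le_card hsub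
  rw [Finset.card_insert_of_notMem (by simpa using hyw)] at hcard
  have := hmax (mem_image_of_mem _ (W.add_mem hw (W.smul_mem t hv))) (by simp only; omega)
  simp only at this
  omega

/-! ### Weak*-continuous maps from a Banach space into the dual of `C_p(X)` -/

section WeakStar

variable {X E : Type*} [TopologicalSpace X] [T35Space X] [NormedAddCommGroup E] [NormedSpace ℝ E]

/-- The size of the support is lower semicontinuous for the weak* topology: disjoint bumps around
the points of the support detect one support point each. -/
lemma isClosed_card_support_le (φ : E →ₗ[ℝ] X →₀ ℝ)
    (hφ : ∀ f : C(X, ℝ), Continuous fun e => Finsupp.linearCombination ℝ evalFunctional (φ e) f)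
    (n : ℕ) : IsClosed {e | (φ e).support.card ≤ n} := by
  rw [← isOpen_compl_iff, isOpen_iff_mem_nhds]
  intro e he
  have he' : n < (φ e).support.card := by simpa using he
  obtain ⟨U, hU, hdisj⟩ := (φ e).support.finite_toSet.t2_separation
  choose f hfx hf using fun x => exists_continuousMap_eq_one_eqOn_zero (hU x).2 (hU x).1
  have hne : ∀ x ∈ (φ e).support,
      Finsupp.linearCombination ℝ evalFunctional (φ e) (f x) ≠ 0 := by
    intro x hx
    rw [linearCombination_evalFunctional, Finset.sum_eq_single_of_mem x hx]
    · simpa [hfx] using hx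
    · intro y hy hyx
      rw [hf x y fun h => (hdisj hy hx hyx).le_bot ⟨(hU y).1, h⟩, mul_zero]
  have hev : ∀ᶠ e' in 𝓝 e, ∀ x ∈ (φ e).support,
      Finsupp.linearCombination ℝ evalFunctional (φ e') (f x) ≠ 0 :=
    (Filter.eventually_all_finset _).mpr fun x hx => (hφ (f x)).continuousAt.eventually_ne (hne x hx)
  filter_upwards [hev] with e' he''
  have hex : ∀ x ∈ (φ e).support, ∃ y ∈ (φ e').support, y ∈ U x := by
    intro x hx
    have h := he'' x hx
    rw [linearCombination_evalFunctional] at h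
    obtain ⟨y, hy, hy0⟩ := Finset.exists_ne_zero_of_sum_ne_zero h
    exact ⟨y, hy, by_contra fun hyU => hy0 (by rw [hf x y hyU, mul_zero])⟩
  choose! g hg hgU using hex
  have hle : (φ e).support.card ≤ (φ e').support.card := by
    refine Finset.card_le_card_of_injOn g hg fun x hx y hy hxy => by_contra fun hne => ?_
    exact (hdisj hx hy hne).le_bot ⟨hgU x hx, hxy ▸ hgU y hy⟩
  simp only [mem_compl_iff, mem_ofPred_eq, not_le]
  omega

lemma exists_card_support_le [CompleteSpace E] (φ : E →ₗ[ℝ] X →₀ ℝ)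
    (hφ : ∀ f : C(X, ℝ), Continuous fun e => Finsupp.linearCombination ℝ evalFunctional (φ e) f) :
    ∃ n : ℕ, ∀ e, (φ e).support.card ≤ n := by
  classical
  obtain ⟨n, e₀, he₀⟩ := nonempty_interior_of_iUnion_of_closed (isClosed_card_support_le φ hφ)
    (eq_univ_of_forall fun e => mem_iUnion.mpr ⟨(φ e).support.card, le_refl (φ e).support.card⟩)
  refine ⟨n + n, fun e => ?_⟩
  have hlim : Filter.Tendsto (fun t : ℝ => e₀ + t • e) (𝓝[≠] 0) (𝓝 e₀) := by
    have : Continuous fun t : ℝ => e₀ + t • e := by fun_prop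
    simpa using (this.tendsto 0).mono_left nhdsWithin_le_nhds
  obtain ⟨t, htmem, ht⟩ := ((hlim.eventually (mem_interior_iff_mem_nhds.mp he₀)).and
    self_mem_nhdsWithin).exists
  have ht0 : t ≠ 0 := ht
  have h₀ : (φ e₀).support.card ≤ n :=
    interior_subset (s := {e | (φ e).support.card ≤ n}) he₀
  have h₁ : (φ (e₀ + t • e)).support.card ≤ n := htmem
  have hsub : (φ e).support ⊆ (φ (e₀ + t • e)).support ∪ (φ e₀).support := by
    have : φ e = t⁻¹ • (φ (e₀ + t • e) - φ e₀) := by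
      simp [smul_smul, inv_mul_cancel₀ ht0]
    rw [this]
    exact Finsupp.support_smul.trans Finsupp.support_sub
  exact (Finset.card_le_card hsub).trans ((Finset.card_union_le _ _).trans (add_le_add h₁ h₀))

lemma finiteDimensional_range_of_continuous [CompleteSpace E] (φ : E →ₗ[ℝ] X →₀ ℝ)
    (hφ : ∀ f : C(X, ℝ), Continuous fun e => Finsupp.linearCombination ℝ evalFunctional (φ e) f) :
    FiniteDimensional ℝ (LinearMap.range φ) := by
  obtain ⟨n, hn⟩ := exists_card_support_le φ hφ
  obtain ⟨s, hs⟩ := exists_supported_of_card_support_le (LinearMap.range φ) (n := n)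
    (by rintro _ ⟨e, rfl⟩; exact hn e)
  have : FiniteDimensional ℝ (Finsupp.supported ℝ ℝ (s : Set X)) :=
    Module.Finite.equiv (Finsupp.supportedEquivFinsupp (M := ℝ) (R := ℝ) (s : Set X)).symm
  exact Submodule.finiteDimensional_of_le hs

end WeakStar

/-! ### Comparison of the topologies on `C(Y)` -/

lemma continuous_weakTopology {Y : Type*} [TopologicalSpace Y] (l : C(Y, ℝ) →L[ℝ] ℝ) :
    Continuous[weakTopology Y, inferInstance] l := by
  have h : Continuous fun z : WeakSpace ℝ C(Y, ℝ) => topDualPairing ℝ C(Y, ℝ) l z :=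
    WeakBilin.eval_continuous (topDualPairing ℝ C(Y, ℝ)).flip l
  exact @Continuous.comp _ _ _ (weakTopology Y) inferInstance inferInstance
    (toWeakSpace ℝ C(Y, ℝ)) _ h (@continuous_induced_dom _ _ (toWeakSpace ℝ C(Y, ℝ)) inferInstance)

lemma compactOpenTopology_le_weakTopology (Y : Type*) [TopologicalSpace Y] :
    compactOpenTopology Y ≤ weakTopology Y :=
  continuous_iff_le_induced.mp (toWeakSpaceCLM ℝ C(Y, ℝ)).continuous

lemma weakTopology_le_pointwiseTopology (Y : Type*) [TopologicalSpace Y] :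
    weakTopology Y ≤ pointwiseTopology Y := by
  rw [← continuous_iff_le_induced]
  have h (y : Y) := continuous_weakTopology (ContinuousMap.evalCLM ℝ y : C(Y, ℝ) →L[ℝ] ℝ)
  let _ := weakTopology Y
  exact continuous_pi h

lemma pointwiseTopology_le_compactOpenTopology {Y : Type*} [TopologicalSpace Y]
    (hY : ∀ K : Set Y, IsCompact K → K.Finite) :
    pointwiseTopology Y ≤ compactOpenTopology Y := by
  rw [compactOpenTopology, ContinuousMap.compactOpen_eq]
  refine le_generateFrom ?_
  rintro _ ⟨K, hK, U, hU, rfl⟩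
  exact ⟨K.pi fun _ => U, isOpen_set_pi (hY K hK) fun _ _ => hU, rfl⟩

/-! ### Compact subsets of the target space -/

section Compact

variable {X Y : Type*} [TopologicalSpace X] [T35Space X] [TopologicalSpace Y]

/-- The adjoint of `T` on functionals that factor through a continuous linear map `R` into a normed
space `F`. -/
lemma exists_adjoint {F : Type*} [NormedAddCommGroup F] [NormedSpace ℝ F]
    (T : C(X, ℝ) →ₗ[ℝ] C(Y, ℝ)) (hT : Continuous[pointwiseTopology X, weakTopology Y] T)
    (R : C(Y, ℝ) →L[ℝ] F) :
    ∃ φ : StrongDual ℝ F →ₗ[ℝ] X →₀ ℝ, ∀ e f,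
      Finsupp.linearCombination ℝ evalFunctional (φ e) f = e (R (T f)) := by
  let A : StrongDual ℝ F →ₗ[ℝ] (C(X, ℝ) →ₗ[ℝ] ℝ) :=
    { toFun := fun e => (e ∘L R).toLinearMap ∘ₗ T
      map_add' := fun _ _ => rfl
      map_smul' := fun _ _ => rfl }
  have hA : ∀ e, A e ∈ Submodule.span ℝ (range (evalFunctional : X → C(X, ℝ) →ₗ[ℝ] ℝ)) :=
    fun e => mem_span_evalFunctional _
      (@Continuous.comp _ _ _ (pointwiseTopology X) (weakTopology Y) _ _ _
        (continuous_weakTopology (e ∘L R)) hT)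
  refine ⟨(linearIndependent_evalFunctional X).repr ∘ₗ A.codRestrict _ hA, fun e f => ?_⟩
  exact congrArg (fun l : C(X, ℝ) →ₗ[ℝ] ℝ => l f)
    ((linearIndependent_evalFunctional X).linearCombination_repr ⟨A e, hA e⟩)

/-- A continuous linear map from `C_k(Y)` into a normed space factors only finitely many linearly
independent functionals when `C_k(Y)_w` is a continuous linear image of `C_p(X)`. -/
lemma finite_of_linearIndependent_comp {F ι : Type*} [NormedAddCommGroup F] [NormedSpace ℝ F]
    (T : C(X, ℝ) →ₗ[ℝ] C(Y, ℝ)) (hT : Continuous[pointwiseTopology X, weakTopology Y] T)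
    (hsurj : Function.Surjective T) (R : C(Y, ℝ) →L[ℝ] F) (δ : ι → StrongDual ℝ F)
    (hδ : LinearIndependent ℝ fun i => (δ i ∘L R).toLinearMap) : Finite ι := by
  obtain ⟨φ, hφ⟩ := exists_adjoint T hT R
  have hfin : FiniteDimensional ℝ (LinearMap.range φ) :=
    finiteDimensional_range_of_continuous φ fun f => by simp only [hφ]; fun_prop
  have hadj : (fun i => Finsupp.linearCombination ℝ evalFunctional (φ (δ i))) =
      fun i => T.dualMap (δ i ∘L R).toLinearMap := by
    ext i f
    rw [hφ]
    rfl
  have hind : LinearIndependent ℝ fun i => T.dualMap (δ i ∘L R).toLinearMap :=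
    hδ.map' T.dualMap (LinearMap.ker_eq_bot.mpr (LinearMap.dualMap_injective_of_surjective hsurj))
  rw [← hadj] at hind
  have hrange : LinearIndependent ℝ fun i => φ.rangeRestrict (δ i) :=
    LinearIndependent.of_comp
      (Finsupp.linearCombination ℝ evalFunctional ∘ₗ (LinearMap.range φ).subtype) hind
  exact hrange.finite

lemma finite_of_isCompact [T35Space Y] (T : C(X, ℝ) →ₗ[ℝ] C(Y, ℝ))
    (hT : Continuous[pointwiseTopology X, weakTopology Y] T) (hsurj : Function.Surjective T)
    {K : Set Y} (hK : IsCompact K) : K.Finite := by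
  have : CompactSpace K := isCompact_iff_compactSpace.mp hK
  let R : C(Y, ℝ) →L[ℝ] C(K, ℝ) :=
    { toFun := fun g => g.restrict K
      map_add' := fun _ _ => rfl
      map_smul' := fun _ _ => rfl
      cont := ContinuousMap.continuous_restrict K }
  have : Finite K := finite_of_linearIndependent_comp T hT hsurj R
    (fun y => ContinuousMap.evalCLM ℝ y)
    ((linearIndependent_evalFunctional Y).comp ((↑) : K → Y) Subtype.val_injective)
  exact K.toFinite

end Compact

theorem theorem4p3 {X Y : Type*} [TopologicalSpace X] [T35Space X] [TopologicalSpace Y]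
    [T35Space Y] (hX : IsDeltaSpace X) :
    (∀ T : C(X, ℝ) →ₗ[ℝ] C(Y, ℝ),
      Continuous[pointwiseTopology X, weakTopology Y] T → Function.Surjective T →
        weakTopology Y = pointwiseTopology Y ∧ pointwiseTopology Y = compactOpenTopology Y) ∧
    (Infinite Y → CompactSpace Y →
      ¬ ∃ T : C(X, ℝ) →ₗ[ℝ] C(Y, ℝ),
        Continuous[pointwiseTopology X, weakTopology Y] T ∧ Function.Surjective T) := by
  refine ⟨fun T hT hsurj => ?_, ?_⟩
  · have hpk := pointwiseTopology_le_compactOpenTopology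
      fun K (hK : IsCompact K) => finite_of_isCompact T hT hsurj hK
    have hkw := compactOpenTopology_le_weakTopology Y
    have hwp := weakTopology_le_pointwiseTopology Y
    exact ⟨le_antisymm hwp (hpk.trans hkw), le_antisymm hpk (hkw.trans hwp)⟩
  · rintro hinf hcomp ⟨T, hT, hsurj⟩
    exact infinite_univ (finite_of_isCompact T hT hsurj isCompact_univ)
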